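/- Let $H$ be a complex Hilbert space (of any dimension, possibly $0$), with inner product linear in the first variable, and let $\hat\otimes_2$ denote the Hilbertian tensor product (the completion of the algebraic tensor product for $\langle x\otimes y,x'\otimes y'\rangle=\langle x,x'\rangle\langle y,y'\rangle$), with its unitary associativity constraint $\alpha\colon (H\hat\otimes_2H)\hat\otimes_2H\to H\hat\otimes_2(H\hat\otimes_2H)$. A *structure of commutative Hilbertian Frobenius semigroup* on $H$ is a bounded linear map $\mu\colon H\hat\otimes_2H\to H$ that is commutative, associative, and satisfies $$\mu^\dagger\mu=(\mathrm{id}\hat\otimes_2\mu)\,\alpha\,(\mu^\dagger\hat\otimes_2\mathrm{id})=(\mu\hat\otimes_2\mathrm{id})\,\alpha^{-1}\,(\mathrm{id}\hat\otimes_2\mu^\dagger),$$ where $\mu^\dagger$, the Hilbert space adjoint of $\mu$, is the comultiplication. It is *special* if $\mu\mu^\dagger=\mathrm{id}_H$; it is *semisimple* (resp. *radical*) if the Jacobson radical of the algebra $(H,\ xy:=\mu(x\otimes y))$, i.e. the intersection of its maximal modular ideals ($H$ itself if there are none), is $0$ (resp. $H$). A bounded linear map $f$ is a *partial isometry* if $ff^\dagger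 f=f$. The set of *group-like elements* of $\mu$ is $G(\mu):=\{x\in H\setminus\{0\}:\mu^\dagger(x)=x\otimes x\}$. An *orthogonal set* of $H$ is a set of pairwise orthogonal non-zero vectors; it is an *orthonormal set* if moreover all its elements have norm $1$. An *orthogonal* (resp. *orthonormal*) *basis* is an orthogonal (resp. orthonormal) set $X$ with $X^\perp=0$. A set $X\subseteq H$ is *bounded above* if there is $C>0$ with $\|x\|\le C$ for all $x\in X$. Then the assignment $\mu\mapsto G(\mu)$ restricts to bijections 1. from the structures of commutative Hilbertian Frobenius semigroups on $H$ with $\mu\ne0$ onto the non-empty bounded above orthogonal sets of $H$; 2. from the structures of semisimple commutative Hilbertian Frobenius semigroups on $H$ onto the bounded above orthogonal bases of $H$; 3. from the structures of commutative Hilbertian Frobenius semigroups on $H$ whose comultiplication $\mu^\dagger$ is a non-zero partial isometry onto the non-empty orthonormal sets of $H$; 4. from the structures of commutative special Hilbertian Frobenius semigroups on $H$ onto the orthonormal bases of $H$; moreover any two such structures $\mu,\nu$ are unitarily isomorphic: there is a unitary $U\colon H\to H$ with $U\mu=\nu(U\hat\otimes_2U)$. 5. The zero multiplication is the unique structure of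 radical commutative Hilbertian Frobenius semigroup on $H$, and it corresponds to the empty orthogonal set: a structure of commutative Hilbertian Frobenius semigroup $\mu$ satisfies $G(\mu)=\emptyset$ if and only if $\mu=0$. The inverse of these bijections sends $X=G(\mu)$ to the structure given, for $u,v\in H$, by the unconditionally convergent sum $$\mu(u\otimes v)=\sum_{x\in X}\frac{\langle u,x\rangle\langle v,x\rangle}{\|x\|^2}\,x .$$ -/

import Mathlib

open scoped TensorProduct

namespace HilbFrob

noncomputable section

variable {H K L M : Type*}
  [NormedAddCommGroup H] [InnerProductSpace ℂ H]
  [NormedAddCommGroup K] [InnerProductSpace ℂ K]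
  [NormedAddCommGroup L] [InnerProductSpace ℂ L]
  [NormedAddCommGroup M] [InnerProductSpace ℂ M]

/-! ### The Hilbert space tensor product -/

/-- The Hilbertian tensor product: the completion of the algebraic tensor product for the inner
product determined by `⟪x ⊗ y, x' ⊗ y'⟫ = ⟪x, x'⟫ ⟪y, y'⟫`. -/
abbrev HTensor (H K : Type*) [NormedAddCommGroup H] [InnerProductSpace ℂ H]
    [NormedAddCommGroup K] [InnerProductSpace ℂ K] : Type _ :=
  UniformSpace.Completion (H ⊗[ℂ] K)

/-- The canonical isometric embedding of the algebraic tensor product. -/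
def toH (H K : Type*) [NormedAddCommGroup H] [InnerProductSpace ℂ H]
    [NormedAddCommGroup K] [InnerProductSpace ℂ K] : H ⊗[ℂ] K →ₗᵢ[ℂ] HTensor H K :=
  UniformSpace.Completion.toComplₗᵢ

/-- The elementary tensor `x ⊗ y` in the Hilbertian tensor product. -/
def htmul (x : H) (y : K) : HTensor H K := toH H K (x ⊗ₜ[ℂ] y)

theorem denseRange_toH : DenseRange (toH H K) := UniformSpace.Completion.denseRange_coe

theorem inner_htmul (x x' : H) (y y' : K) :
    inner ℂ (htmul x y) (htmul x' y') = inner ℂ x x' * inner ℂ y y' := by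
  simp [htmul]

/-- Two bounded linear maps that agree on elementary tensors are equal. -/
theorem ext_htmul {f g : HTensor H K →L[ℂ] M} (h : ∀ x y, f (htmul x y) = g (htmul x y)) :
    f = g := by
  refine ContinuousLinearMap.coeFn_injective (denseRange_toH.equalizer f.cont g.cont ?_)
  have : f.toLinearMap ∘ₗ (toH H K).toLinearMap = g.toLinearMap ∘ₗ (toH H K).toLinearMap :=
    TensorProduct.ext' h
  funext t
  exact LinearMap.congr_fun this t

/-- The tensor product `f ⊗ g` of two bounded linear maps. -/
def hmap (f : H →L[ℂ] L) (g : K →L[ℂ] M) : HTensor H K →L[ℂ] HTensor L M :=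
  ContinuousLinearMap.extend
    ((toH L M).toContinuousLinearMap ∘L TensorProduct.mapL f g) (toH H K).toContinuousLinearMap

@[simp] theorem hmap_htmul (f : H →L[ℂ] L) (g : K →L[ℂ] M) (x : H) (y : K) :
    hmap f g (htmul x y) = htmul (f x) (g y) :=
  ContinuousLinearMap.extend_eq (e := (toH H K).toContinuousLinearMap) _ denseRange_toH
    (toH H K).isometry.isUniformInducing (x ⊗ₜ[ℂ] y)

/-- The symmetry `H ⊗ K ≃ K ⊗ H`, a unitary map. -/
def hcomm (H K : Type*) [NormedAddCommGroup H] [InnerProductSpace ℂ H]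
    [NormedAddCommGroup K] [InnerProductSpace ℂ K] : HTensor H K ≃ₗᵢ[ℂ] HTensor K H :=
  (TensorProduct.comm ℂ H K).extendOfIsometry (toH H K).toLinearMap (toH K H).toLinearMap
    denseRange_toH denseRange_toH (fun t => by
      simp only [LinearIsometry.coe_toLinearMap, LinearIsometry.norm_map]
      exact TensorProduct.norm_comm t)

@[simp] theorem hcomm_htmul (x : H) (y : K) : hcomm H K (htmul x y) = htmul y x :=
  LinearEquiv.extendOfIsometry_eq (f := TensorProduct.comm ℂ H K) (e₁ := (toH H K).toLinearMap)
    (e₂ := (toH K H).toLinearMap) _ _ _ (x ⊗ₜ[ℂ] y)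

/-- The isometric embedding of `(H ⊗ K) ⊗ L` (algebraic) into its Hilbertian version. -/
def toHL (H K L : Type*) [NormedAddCommGroup H] [InnerProductSpace ℂ H]
    [NormedAddCommGroup K] [InnerProductSpace ℂ K] [NormedAddCommGroup L] [InnerProductSpace ℂ L] :
    (H ⊗[ℂ] K) ⊗[ℂ] L →ₗᵢ[ℂ] HTensor (HTensor H K) L :=
  (toH (HTensor H K) L).comp (TensorProduct.mapIsometry (toH H K) LinearIsometry.id)

/-- The isometric embedding of `H ⊗ (K ⊗ L)` (algebraic) into its Hilbertian version. -/
def toHR (H K L : Type*) [NormedAddCommGroup H] [InnerProductSpace ℂ H]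
    [NormedAddCommGroup K] [InnerProductSpace ℂ K] [NormedAddCommGroup L] [InnerProductSpace ℂ L] :
    H ⊗[ℂ] (K ⊗[ℂ] L) →ₗᵢ[ℂ] HTensor H (HTensor K L) :=
  (toH H (HTensor K L)).comp (TensorProduct.mapIsometry LinearIsometry.id (toH K L))

theorem continuous_htmul : Continuous fun p : H × K => htmul p.1 p.2 :=
  (toH H K).continuous.comp TensorProduct.continuous_tmul

/-- A submodule-closure criterion for density: the closure of the range contains all elementary
tensors. -/
theorem denseRange_of_htmul {V : Type*} [AddCommGroup V] [Module ℂ V] (e : V →ₗ[ℂ] HTensor H K)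
    (h : ∀ x y, htmul x y ∈ closure (Set.range e)) : DenseRange e := by
  have h2 : ∀ t : H ⊗[ℂ] K, toH H K t ∈ (LinearMap.range e).topologicalClosure := by
    intro t
    induction t with
    | zero => simp
    | tmul x y => simpa [← SetLike.mem_coe, Submodule.topologicalClosure_coe] using! h x y
    | add a b ha hb => rw [map_add]; exact add_mem ha hb
  intro z
  refine denseRange_toH.induction_on (p := fun z => z ∈ closure (Set.range e)) z
    isClosed_closure (fun t => ?_)
  simpa [← SetLike.mem_coe, Submodule.topologicalClosure_coe] using! h2 t

theorem denseRange_toHL : DenseRange (toHL H K L) := by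
  refine denseRange_of_htmul (toHL H K L).toLinearMap (fun s z => ?_)
  refine denseRange_toH.induction_on
    (p := fun s => htmul s z ∈ closure (Set.range (toHL H K L).toLinearMap)) s ?_ (fun t => ?_)
  · exact isClosed_closure.preimage (continuous_htmul.comp (by fun_prop : Continuous fun s => (s, z)))
  · exact subset_closure ⟨t ⊗ₜ[ℂ] z, rfl⟩

theorem denseRange_toHR : DenseRange (toHR H K L) := by
  refine denseRange_of_htmul (toHR H K L).toLinearMap (fun x s => ?_)
  refine denseRange_toH.induction_on
    (p := fun s => htmul x s ∈ closure (Set.range (toHR H K L).toLinearMap)) s ?_ (fun t => ?_)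
  · exact isClosed_closure.preimage (continuous_htmul.comp (by fun_prop : Continuous fun s => (x, s)))
  · exact subset_closure ⟨x ⊗ₜ[ℂ] t, rfl⟩

/-- The associativity constraint `(H ⊗ K) ⊗ L ≃ H ⊗ (K ⊗ L)`, a unitary map. -/
def hassoc (H K L : Type*) [NormedAddCommGroup H] [InnerProductSpace ℂ H]
    [NormedAddCommGroup K] [InnerProductSpace ℂ K] [NormedAddCommGroup L] [InnerProductSpace ℂ L] :
    HTensor (HTensor H K) L ≃ₗᵢ[ℂ] HTensor H (HTensor K L) :=
  (TensorProduct.assoc ℂ H K L).extendOfIsometry (toHL H K L).toLinearMap (toHR H K L).toLinearMap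
    denseRange_toHL denseRange_toHR (fun t => by
      simp only [LinearIsometry.coe_toLinearMap, LinearIsometry.norm_map]
      exact TensorProduct.norm_assoc t)

@[simp] theorem hassoc_htmul (x : H) (y : K) (z : L) :
    hassoc H K L (htmul (htmul x y) z) = htmul x (htmul y z) :=
  LinearEquiv.extendOfIsometry_eq (f := TensorProduct.assoc ℂ H K L)
    (e₁ := (toHL H K L).toLinearMap) (e₂ := (toHR H K L).toLinearMap) _ _ _ ((x ⊗ₜ[ℂ] y) ⊗ₜ[ℂ] z)

/-! ### Hilbertian Frobenius semigroups -/

/-- The comultiplication of a bounded multiplication: its Hilbert space adjoint. -/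
abbrev comul [CompleteSpace H] (μ : HTensor H H →L[ℂ] H) : H →L[ℂ] HTensor H H :=
  ContinuousLinearMap.adjoint μ

/-- `μ` is the multiplication of a commutative Hilbertian Frobenius semigroup on `H`. -/
structure IsFrobenius [CompleteSpace H] (μ : HTensor H H →L[ℂ] H) : Prop where
  comm : μ ∘L (hcomm H H : HTensor H H →L[ℂ] HTensor H H) = μ
  assoc : μ ∘L hmap μ (.id ℂ H) =
    μ ∘L hmap (.id ℂ H) μ ∘L
      (hassoc H H H : HTensor (HTensor H H) H →L[ℂ] HTensor H (HTensor H H))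
  frobenius_left : comul μ ∘L μ =
    hmap (.id ℂ H) μ ∘L
      (hassoc H H H : HTensor (HTensor H H) H →L[ℂ] HTensor H (HTensor H H)) ∘L
      hmap (comul μ) (.id ℂ H)
  frobenius_right : comul μ ∘L μ =
    hmap μ (.id ℂ H) ∘L
      ((hassoc H H H).symm : HTensor H (HTensor H H) →L[ℂ] HTensor (HTensor H H) H) ∘L
      hmap (.id ℂ H) (comul μ)

/-- Special: the multiplication is coisometric, i.e. the comultiplication is an isometry. -/
def IsSpecial [CompleteSpace H] (μ : HTensor H H →L[ℂ] H) : Prop :=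
  μ ∘L comul μ = .id ℂ H

/-- A partial isometry: `f f† f = f`. -/
def IsPartialIsometry [CompleteSpace H] [CompleteSpace K] (f : H →L[ℂ] K) : Prop :=
  f ∘L ContinuousLinearMap.adjoint f ∘L f = f

/-- The group-like elements: `x ≠ 0` with `μ†(x) = x ⊗ x`. -/
def groupLike [CompleteSpace H] (μ : HTensor H H →L[ℂ] H) : Set H :=
  {x | x ≠ 0 ∧ comul μ x = htmul x x}

/-! ### The Jacobson radical of the underlying (not necessarily unital) algebra -/

/-- A left ideal of the algebra `H` with product `x y = μ (x ⊗ y)`. -/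
def IsLeftIdeal (μ : HTensor H H →L[ℂ] H) (I : Submodule ℂ H) : Prop :=
  ∀ a : H, ∀ x ∈ I, μ (htmul a x) ∈ I

/-- A left ideal is modular if the algebra has a right identity modulo it. -/
def IsModular (μ : HTensor H H →L[ℂ] H) (I : Submodule ℂ H) : Prop :=
  ∃ e : H, ∀ x : H, x - μ (htmul x e) ∈ I

/-- Maximal modular left ideals: modular, and maximal among the proper left ideals. -/
structure IsMaximalModular (μ : HTensor H H →L[ℂ] H) (I : Submodule ℂ H) : Prop where
  isLeftIdeal : IsLeftIdeal μ I
  isModular : IsModular μ I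
  ne_top : I ≠ ⊤
  maximal : ∀ I' : Submodule ℂ H, IsLeftIdeal μ I' → I ≤ I' → I' ≠ ⊤ → I' = I

/-- The Jacobson radical: the intersection of all maximal modular left ideals (all of `H` if there
are none). -/
def jacobson (μ : HTensor H H →L[ℂ] H) : Submodule ℂ H :=
  sInf {I | IsMaximalModular μ I}

def IsSemisimple (μ : HTensor H H →L[ℂ] H) : Prop := jacobson μ = ⊥

def IsRadical (μ : HTensor H H →L[ℂ] H) : Prop := jacobson μ = ⊤

/-- `U` is a unitary isomorphism of semigroups `(H, μ) → (K, ν)`. -/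
def IsUnitaryIso (μ : HTensor H H →L[ℂ] H) (ν : HTensor K K →L[ℂ] K) (U : H ≃ₗᵢ[ℂ] K) : Prop :=
  (U : H →L[ℂ] K) ∘L μ = ν ∘L hmap (U : H →L[ℂ] K) (U : H →L[ℂ] K)

/-! ### Orthogonal sets -/

/-- A set of pairwise orthogonal non-zero vectors. -/
def IsOrthogonalSet (X : Set H) : Prop :=
  (0 : H) ∉ X ∧ X.Pairwise fun x y => inner ℂ x y = 0

/-- An orthogonal set in which every vector has norm one. -/
def IsOrthonormalSet (X : Set H) : Prop :=
  IsOrthogonalSet X ∧ ∀ x ∈ X, ‖x‖ = 1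

/-- The orthogonal complement of `X` is zero. -/
def IsTotal (X : Set H) : Prop := ∀ u : H, (∀ x ∈ X, inner ℂ x u = 0) → u = 0

def IsBddAbove (X : Set H) : Prop := ∃ C : ℝ, 0 < C ∧ ∀ x ∈ X, ‖x‖ ≤ C

end

end HilbFrob

/-!
The multiplication operators of a commutative Hilbertian Frobenius semigroup commute with each
other, by associativity, and with each other's adjoints, by the Frobenius relation. Unless it
vanishes, such an operator is therefore detected by a character of the commutative C⋆-algebra they
generate; as a functional on `H` this character has the form `⟪g, ·⟫`, and multiplicativity says
that `g` is group-like. Hence a vector orthogonal to all group-like elements annihilates `H`.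

For `g` group-like the Frobenius relation computes `μ† (g a)` both as `g ⊗ g a` and as `g a ⊗ g`,
so `g a = ⟪g, a⟫ g`. Thus `μ` is diagonal with respect to the orthogonal set of its group-like
elements, all of norm at most `‖μ‖`, and is determined by it. Conversely, a bounded orthogonal set
carries a diagonal multiplication, whose Frobenius identities need only be checked on the set and
on its orthogonal complement.
-/

namespace HilbFrob

open ContinuousLinearMap (adjoint)

section InnerProductSpace

universe u v w

variable {𝕜 F : Type*} {E : Type w} {ι : Type u} {κ : Type v} [RCLike 𝕜]
  [NormedAddCommGroup E] [InnerProductSpace 𝕜 E] [NormedAddCommGroup F] [InnerProductSpace 𝕜 F]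

theorem ext_of_eqOn_of_orthogonal [CompleteSpace E] {V : Type*} [AddCommGroup V] [Module 𝕜 V]
    [TopologicalSpace V] [T2Space V] {X : Set E} {f g : E →L[𝕜] V} (hX : Set.EqOn f g X)
    (hperp : ∀ n, (∀ x ∈ X, inner 𝕜 x n = 0) → f n = g n) : f = g := by
  ext u
  obtain ⟨p, hp, n, hn, rfl⟩ :=
    (Submodule.span 𝕜 X).topologicalClosure.exists_add_mem_mem_orthogonal u
  have hXn : ∀ x ∈ X, inner 𝕜 x n = 0 := fun x hx =>
    hn x (Submodule.le_topologicalClosure _ (Submodule.subset_span hx))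
  rw [map_add, map_add, ContinuousLinearMap.eqOn_closure_span hX hp, hperp n hXn]

theorem adjoint_linearIsometry_orthogonalFamily_apply [CompleteSpace E] {w : ι → E}
    (hw : Orthonormal 𝕜 w) (t : E) (i : ι) :
    adjoint hw.orthogonalFamily.linearIsometry.toContinuousLinearMap t i = inner 𝕜 (w i) t := by
  classical
  have hsingle : hw.orthogonalFamily.linearIsometry (lp.single 2 i 1) = w i := by simp
  have h := lp.inner_single_left (𝕜 := 𝕜) i (1 : 𝕜)
    (adjoint hw.orthogonalFamily.linearIsometry.toContinuousLinearMap t)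
  rw [ContinuousLinearMap.adjoint_inner_right, LinearIsometry.coe_toContinuousLinearMap,
    hsingle] at h
  simpa using h.symm

theorem exists_hasSum_mul_inner_smul [CompleteSpace E] [CompleteSpace F] {v : ι → F} {w : ι → E}
    (hv : Orthonormal 𝕜 v) (hw : Orthonormal 𝕜 w) {c : ι → 𝕜} {C : ℝ} (hC : 0 ≤ C)
    (hc : ∀ i, ‖c i‖ ≤ C) :
    ∃ T : E →L[𝕜] F, ∀ t, HasSum (fun i => (c i * inner 𝕜 (w i) t) • v i) (T t) := by
  let synthesis := hv.orthogonalFamily.linearIsometry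
  let analysis := adjoint hw.orthogonalFamily.linearIsometry.toContinuousLinearMap
  let scaling : lp (fun _ : ι => 𝕜) 2 →L[𝕜] lp (fun _ : ι => 𝕜) 2 :=
    lp.mapCLM 2 (fun i => c i • ContinuousLinearMap.id 𝕜 𝕜) hC fun i => by
      simpa [norm_smul] using hc i
  refine ⟨synthesis.toContinuousLinearMap ∘L scaling ∘L analysis, fun t => ?_⟩
  convert! hv.orthogonalFamily.hasSum_linearIsometry (scaling (analysis t)) using 2 with i
  simp [scaling, analysis, adjoint_linearIsometry_orthogonalFamily_apply hw]

theorem lift_mk_le_lift_mk_of_hilbertBasis {e : ι → E} (he : Orthonormal 𝕜 e)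
    (b : HilbertBasis κ 𝕜 E) :
    Cardinal.lift.{v} (Cardinal.mk ι) ≤ Cardinal.lift.{u} (Cardinal.mk κ) := by
  cases finite_or_infinite κ with
  | inl hfin =>
    have := Fintype.ofFinite κ
    have hrank := Cardinal.lift_le.{v}.2 he.linearIndependent.cardinal_lift_le_rank
    have hb := congrArg Cardinal.lift.{u} b.toOrthonormalBasis.toBasis.mk_eq_rank
    rw [Cardinal.lift_lift, Cardinal.lift_lift] at hrank hb
    rw [← Cardinal.lift_le.{w}, Cardinal.lift_lift, Cardinal.lift_lift]
    exact hrank.trans_eq hb.symm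
  | inr hinf =>
    have hcoeff : ∀ i, ∃ k, inner 𝕜 (e i) (b k) ≠ 0 := fun i => by
      by_contra! h
      refine he.ne_zero i (b.repr.injective ?_)
      ext k
      simp [b.repr_apply_apply, ← inner_conj_symm (b k), h k]
    choose f hf using hcoeff
    have hfibre : ∀ k, Cardinal.lift.{v} (Cardinal.mk (f ⁻¹' {k})) ≤ Cardinal.aleph0 := fun k =>
      Cardinal.lift_le_aleph0.2 ((he.inner_products_summable (b k)).countable_support.mono
        (by rintro i rfl; simpa using! hf i)).le_aleph0
    calc Cardinal.lift.{v} (Cardinal.mk ι)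
        ≤ Cardinal.lift.{u} (Cardinal.mk κ) * Cardinal.aleph0 :=
          Cardinal.lift_mk_le_lift_mk_mul_of_lift_mk_preimage_le f hfibre
      _ = Cardinal.lift.{u} (Cardinal.mk κ) :=
          Cardinal.mul_aleph0_eq (Cardinal.aleph0_le_lift.2 (Cardinal.aleph0_le_mk κ))

theorem nonempty_equiv_of_hilbertBasis (b : HilbertBasis ι 𝕜 E) (b' : HilbertBasis κ 𝕜 E) :
    Nonempty (ι ≃ κ) :=
  Cardinal.lift_mk_eq'.1 <| (lift_mk_le_lift_mk_of_hilbertBasis b.orthonormal b').antisymm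
    (lift_mk_le_lift_mk_of_hilbertBasis b'.orthonormal b)

theorem exists_linearIsometryEquiv_of_equiv [CompleteSpace F] (b : HilbertBasis ι 𝕜 E)
    (b' : HilbertBasis κ 𝕜 F) (e : ι ≃ κ) : ∃ U : E ≃ₗᵢ[𝕜] F, ∀ i, U (b i) = b' (e i) := by
  classical
  have hrange : Set.range (b' ∘ e) = Set.range b' := e.surjective.range_comp b'
  let b'' := HilbertBasis.mk (b'.orthonormal.comp e e.injective) (by rw [hrange, b'.dense_span])
  refine ⟨b.repr.trans b''.repr.symm, fun i => ?_⟩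
  simp [b'', HilbertBasis.repr_self]

end InnerProductSpace

section CStarAlgebra

variable {A : Type*} [CStarAlgebra A]

theorem exists_multiplicative_functional_of_commute {V : Type*} [AddCommGroup V] [Module ℂ V]
    [TopologicalSpace V] (Λ : V →L[ℂ] A) (hcomm : ∀ a b, Commute (Λ a) (Λ b))
    (hstar : ∀ a b, Commute (Λ a) (star (Λ b))) {a : V} (ha : Λ a ≠ 0) :
    ∃ χ : V →L[ℂ] ℂ, χ a ≠ 0 ∧ ∀ x y z, Λ z = Λ x * Λ y → χ z = χ x * χ y := by
  let B := StarAlgebra.adjoin ℂ (Set.range Λ)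
  let S := B.topologicalClosure
  have hΛS : ∀ x, Λ x ∈ S := fun x =>
    B.le_topologicalClosure (StarAlgebra.subset_adjoin ℂ _ ⟨x, rfl⟩)
  have hB : IsMulCommutative B :=
    StarAlgebra.isMulCommutative_adjoin ℂ (by rintro _ ⟨x, rfl⟩ _ ⟨y, rfl⟩; exact hcomm x y)
      (by rintro _ ⟨x, rfl⟩ _ ⟨y, rfl⟩; exact hstar x y)
  let _ : CStarAlgebra S :=
    StarSubalgebra.cstarAlgebra S (h_closed := B.isClosed_topologicalClosure)
  let _ : CommCStarAlgebra S :=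
    { (inferInstance : CStarAlgebra S) with
      mul_comm := (B.commRingTopologicalClosure hB.is_comm.comm).mul_comm }
  have hgelfand : WeakDual.gelfandTransform ℂ S ⟨Λ a, hΛS a⟩ ≠ 0 := fun h =>
    ha (congrArg Subtype.val ((gelfandTransform_isometry S).injective (h.trans (map_zero _).symm)))
  obtain ⟨φ, hφ⟩ := DFunLike.ne_iff.mp hgelfand
  let ΛS : V →L[ℂ] S := Λ.codRestrict S.toSubalgebra.toSubmodule hΛS
  refine ⟨WeakDual.CharacterSpace.toCLM φ ∘L ΛS, hφ, fun x y z h => ?_⟩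
  have hΛ : ΛS z = ΛS x * ΛS y := Subtype.ext h
  exact (congrArg φ hΛ).trans (map_mul φ _ _)

end CStarAlgebra

section HTensor

variable {H K L M : Type*}
  [NormedAddCommGroup H] [InnerProductSpace ℂ H]
  [NormedAddCommGroup K] [InnerProductSpace ℂ K]
  [NormedAddCommGroup L] [InnerProductSpace ℂ L]
  [NormedAddCommGroup M] [InnerProductSpace ℂ M]

variable (H K) in
/-- `(x, y) ↦ x ⊗ y` as a bounded bilinear map into the Hilbertian tensor product. -/
noncomputable def htmulL : H →L[ℂ] K →L[ℂ] HTensor H K :=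
  ContinuousLinearMap.compL ℂ K (H ⊗[ℂ] K) (HTensor H K) (toH H K).toContinuousLinearMap ∘L
    TensorProduct.mkL ℂ H K

@[simp] theorem htmulL_apply (x : H) (y : K) : htmulL H K x y = htmul x y := rfl

/-- The bounded bilinear map attached to a bounded linear map on the Hilbertian tensor product.
For a multiplication `μ`, `curry μ a` and `(curry μ).flip a` are the multiplication operators by
`a` on the left and on the right. -/
noncomputable def curry (f : HTensor H K →L[ℂ] M) : H →L[ℂ] K →L[ℂ] M :=
  ContinuousLinearMap.compL ℂ K (HTensor H K) M f ∘L htmulL H K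

@[simp] theorem curry_apply (f : HTensor H K →L[ℂ] M) (x : H) (y : K) :
    curry f x y = f (htmul x y) := rfl

theorem curry_injective : Function.Injective (curry : (HTensor H K →L[ℂ] M) → _) := fun _ _ h =>
  ext_htmul fun x y => DFunLike.congr_fun (DFunLike.congr_fun h x) y

theorem norm_htmul (x : H) (y : K) : ‖htmul x y‖ = ‖x‖ * ‖y‖ := by
  simp [htmul, TensorProduct.norm_tmul]

theorem smul_htmul (c : ℂ) (x : H) (y : K) : htmul (c • x) y = c • htmul x y := by
  simp only [← htmulL_apply, map_smul, smul_apply]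

theorem htmul_smul (c : ℂ) (x : H) (y : K) : htmul x (c • y) = c • htmul x y := by
  simp only [← htmulL_apply, map_smul]

theorem htensor_ext {s t : HTensor H K}
    (h : ∀ x y, inner ℂ s (htmul x y) = inner ℂ t (htmul x y)) : s = t :=
  ext_inner_right ℂ (DFunLike.congr_fun (ext_htmul (f := innerSL ℂ s) (g := innerSL ℂ t) h))

theorem inner_self_smul_eq_of_htmul_comm {x y : H} (h : htmul x y = htmul y x) :
    inner ℂ x x • y = inner ℂ x y • x := by
  refine ext_inner_right ℂ fun z => ?_
  have hz := congrArg (inner ℂ · (htmul x z)) h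
  simpa only [inner_htmul, inner_smul_left, inner_conj_symm] using! hz

theorem adjoint_hmap [CompleteSpace H] [CompleteSpace K] [CompleteSpace L] [CompleteSpace M]
    (f : H →L[ℂ] L) (g : K →L[ℂ] M) : adjoint (hmap f g) = hmap (adjoint f) (adjoint g) :=
  ext_htmul fun x y => htensor_ext fun x' y' => by
    simp only [ContinuousLinearMap.adjoint_inner_left, hmap_htmul, inner_htmul]

theorem orthonormal_htmul {ι κ : Type*} {e : ι → H} {f : κ → K} (he : Orthonormal ℂ e)
    (hf : Orthonormal ℂ f) : Orthonormal ℂ fun p : ι × κ => htmul (e p.1) (f p.2) :=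
  (he.tmul hf).comp_linearIsometry (toH H K)

theorem hmap_id_hassoc_htmul (f : HTensor K L →L[ℂ] M) (s : HTensor H K) (z : L) :
    hmap (.id ℂ H) f (hassoc H K L (htmul s z)) = hmap (.id ℂ H) ((curry f).flip z) s := by
  have h : hmap (.id ℂ H) f ∘L (hassoc H K L : _ →L[ℂ] _) ∘L (htmulL _ L).flip z =
      hmap (.id ℂ H) ((curry f).flip z) := ext_htmul fun x y => by simp
  exact DFunLike.congr_fun h s

theorem hmap_hassoc_symm_htmul (f : HTensor H K →L[ℂ] M) (x : H) (s : HTensor K L) :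
    hmap f (.id ℂ L) ((hassoc H K L).symm (htmul x s)) = hmap (curry f x) (.id ℂ L) s := by
  have hsymm (y : K) (z : L) :
      (hassoc H K L).symm (htmul x (htmul y z)) = htmul (htmul x y) z := by
    rw [LinearIsometryEquiv.symm_apply_eq, hassoc_htmul]
  have h : hmap f (.id ℂ L) ∘L ((hassoc H K L).symm : _ →L[ℂ] _) ∘L htmulL H _ x =
      hmap (curry f x) (.id ℂ L) := ext_htmul fun y z => by simp [hsymm]
  exact DFunLike.congr_fun h s

end HTensor

section Comultiplication

variable {H : Type*} [NormedAddCommGroup H] [InnerProductSpace ℂ H] [CompleteSpace H]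
  {μ : HTensor H H →L[ℂ] H}

theorem comul_eq_iff {c : H} {t : HTensor H H} :
    comul μ c = t ↔ ∀ a b, inner ℂ c (μ (htmul a b)) = inner ℂ t (htmul a b) := by
  simp only [← ContinuousLinearMap.adjoint_inner_left μ]
  exact ⟨fun h _ _ => by rw [h], htensor_ext⟩

theorem mem_groupLike_iff {g : H} :
    g ∈ groupLike μ ↔
      g ≠ 0 ∧ ∀ a b, inner ℂ g (μ (htmul a b)) = inner ℂ g a * inner ℂ g b := by
  simp only [groupLike, Set.mem_ofPred_eq, comul_eq_iff, inner_htmul]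

protected theorem IsFrobenius.mul_comm (hμ : IsFrobenius μ) (a b : H) :
    μ (htmul a b) = μ (htmul b a) := by
  simpa using! DFunLike.congr_fun hμ.comm (htmul b a)

protected theorem IsFrobenius.mul_assoc (hμ : IsFrobenius μ) (a b c : H) :
    μ (htmul (μ (htmul a b)) c) = μ (htmul a (μ (htmul b c))) := by
  simpa using! DFunLike.congr_fun hμ.assoc (htmul (htmul a b) c)

theorem IsFrobenius.comul_mul_eq_hmap_flip (hμ : IsFrobenius μ) (a b : H) :
    comul μ (μ (htmul a b)) = hmap (.id ℂ H) ((curry μ).flip b) (comul μ a) := by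
  simpa [hmap_id_hassoc_htmul] using! DFunLike.congr_fun hμ.frobenius_left (htmul a b)

theorem IsFrobenius.comul_mul_eq_hmap (hμ : IsFrobenius μ) (a b : H) :
    comul μ (μ (htmul a b)) = hmap (curry μ a) (.id ℂ H) (comul μ b) := by
  simpa [hmap_hassoc_symm_htmul] using! DFunLike.congr_fun hμ.frobenius_right (htmul a b)

theorem IsFrobenius.of_forall_htmul (hcomm : ∀ a b, μ (htmul a b) = μ (htmul b a))
    (hassoc : ∀ a b c, μ (htmul (μ (htmul a b)) c) = μ (htmul a (μ (htmul b c))))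
    (hleft : ∀ a b, comul μ (μ (htmul a b)) = hmap (.id ℂ H) ((curry μ).flip b) (comul μ a))
    (hright : ∀ a b, comul μ (μ (htmul a b)) = hmap (curry μ a) (.id ℂ H) (comul μ b)) :
    IsFrobenius μ where
  comm := ext_htmul fun a b => by simpa using! hcomm b a
  assoc := ext_htmul fun s c => by
    have h : (curry μ).flip c ∘L μ = μ ∘L hmap (.id ℂ H) ((curry μ).flip c) :=
      ext_htmul fun a b => by simpa using! hassoc a b c
    simpa [hmap_id_hassoc_htmul] using! DFunLike.congr_fun h s
  frobenius_left := ext_htmul fun a b => by simpa [hmap_id_hassoc_htmul] using! hleft a b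
  frobenius_right := ext_htmul fun a b => by simpa [hmap_hassoc_symm_htmul] using! hright a b

end Comultiplication

section Diagonal

variable {H K : Type*} [NormedAddCommGroup H] [InnerProductSpace ℂ H]
  [NormedAddCommGroup K] [InnerProductSpace ℂ K] {X : Set H} {μ ν : HTensor H H →L[ℂ] H}

/-- The multiplication `μ` is diagonal with respect to `X`: left multiplication by `x ∈ X` is
`⟪x, ·⟫ x`, and left multiplication by a vector orthogonal to `X` vanishes. When `X` is an
orthogonal set this is the multiplication `u v = ∑ x ∈ X, (⟪x, u⟫ ⟪x, v⟫ / ‖x‖ ^ 2) x`. -/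
structure IsDiagonal (X : Set H) (μ : HTensor H H →L[ℂ] H) : Prop where
  mul_of_mem : ∀ x ∈ X, ∀ b, μ (htmul x b) = inner ℂ x b • x
  mul_of_perp : ∀ n, (∀ x ∈ X, inner ℂ x n = 0) → ∀ b, μ (htmul n b) = 0

theorem isDiagonal_empty_iff : IsDiagonal ∅ μ ↔ μ = 0 :=
  ⟨fun h => ext_htmul fun a b => h.mul_of_perp a (by simp) b, by rintro rfl; constructor <;> simp⟩

theorem IsOrthogonalSet.orthonormal_normalize (hX : IsOrthogonalSet X) :
    Orthonormal ℂ fun x : X => ((‖(x : H)‖ : ℂ)⁻¹) • (x : H) := by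
  refine ⟨fun x => norm_smul_inv_norm (ne_of_mem_of_not_mem x.2 hX.1), fun x y hxy => ?_⟩
  simp only [inner_smul_left, inner_smul_right, hX.2 x.2 y.2 (Subtype.coe_ne_coe.2 hxy), mul_zero]

theorem IsOrthogonalSet.isDiagonal_of_hasSum (hX : IsOrthogonalSet X)
    (hμ : ∀ u v, HasSum
      (fun x : X => (inner ℂ (x : H) u * inner ℂ (x : H) v / (‖(x : H)‖ : ℂ) ^ 2) • (x : H))
      (μ (htmul u v))) : IsDiagonal X μ where
  mul_of_mem x hx b := by
    have hx0 : (‖x‖ : ℂ) ≠ 0 := by simpa using ne_of_mem_of_not_mem hx hX.1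
    rw [(hμ x b).unique (hasSum_single ⟨x, hx⟩ fun y hy => ?_)]
    · simp [inner_self_eq_norm_sq_to_K, hx0]
    · simp [hX.2 y.2 hx (Subtype.coe_ne_coe.2 hy)]
  mul_of_perp n hn b := (hμ n b).unique (by simp [hn, hasSum_zero])

variable [CompleteSpace H]

theorem eq_of_mem_groupLike_of_inner_ne_zero {g x : H} (hg : g ∈ groupLike μ)
    (hx : ∀ b, μ (htmul x b) = inner ℂ x b • x) (hgx : inner ℂ g x ≠ 0) : g = x := by
  refine ext_inner_right ℂ fun b => mul_left_cancel₀ hgx ?_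
  rw [← (mem_groupLike_iff.1 hg).2, hx, inner_smul_right, mul_comm]

namespace IsDiagonal

theorem unique (hμ : IsDiagonal X μ) (hν : IsDiagonal X ν) : μ = ν :=
  curry_injective <| ext_of_eqOn_of_orthogonal (𝕜 := ℂ) (X := X)
    (fun x hx => ContinuousLinearMap.ext fun b =>
      (hμ.mul_of_mem x hx b).trans (hν.mul_of_mem x hx b).symm)
    (fun n hn => ContinuousLinearMap.ext fun b =>
      (hμ.mul_of_perp n hn b).trans (hν.mul_of_perp n hn b).symm)

theorem isUnitaryIso {U : H ≃ₗᵢ[ℂ] K} {ν : HTensor K K →L[ℂ] K} (hμ : IsDiagonal X μ)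
    (hν : IsDiagonal (U '' X) ν) : IsUnitaryIso μ ν U := by
  refine ext_htmul fun a b => ?_
  have h : (U : H →L[ℂ] K) ∘L (curry μ).flip b = (curry ν).flip (U b) ∘L (U : H →L[ℂ] K) := by
    refine ext_of_eqOn_of_orthogonal (𝕜 := ℂ) (X := X) (fun x hx => ?_) fun n hn => ?_
    · simp [hμ.mul_of_mem x hx, hν.mul_of_mem (U x) ⟨x, hx, rfl⟩]
    · simp [hμ.mul_of_perp n hn, hν.mul_of_perp (U n) (by simpa using hn)]
  simpa using! DFunLike.congr_fun h a

theorem inner_mul_of_mem (hμ : IsDiagonal X μ) (hX : IsOrthogonalSet X) {x : H} (hx : x ∈ X)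
    (a b : H) : inner ℂ x (μ (htmul a b)) = inner ℂ x a * inner ℂ x b := by
  have h : innerSL ℂ x ∘L (curry μ).flip b = inner ℂ x b • innerSL ℂ x := by
    refine ext_of_eqOn_of_orthogonal (𝕜 := ℂ) (X := X) (fun y hy => ?_) fun n hn => ?_
    · obtain rfl | hxy := eq_or_ne x y
      · simp [hμ.mul_of_mem x hx]
      · simp [hμ.mul_of_mem y hy, hX.2 hx hy hxy]
    · simp [hμ.mul_of_perp n hn, hn x hx]
  simpa [mul_comm] using! DFunLike.congr_fun h a

theorem inner_mul_of_perp (hμ : IsDiagonal X μ) {n : H} (hn : ∀ x ∈ X, inner ℂ x n = 0)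
    (a b : H) : inner ℂ n (μ (htmul a b)) = 0 := by
  have h : innerSL ℂ n ∘L (curry μ).flip b = 0 := by
    refine ext_of_eqOn_of_orthogonal (𝕜 := ℂ) (X := X) (fun x hx => ?_) fun m hm => ?_
    · simp [hμ.mul_of_mem x hx, inner_eq_zero_symm.1 (hn x hx)]
    · simp [hμ.mul_of_perp m hm]
  exact DFunLike.congr_fun h a

theorem comul_of_mem (hμ : IsDiagonal X μ) (hX : IsOrthogonalSet X) {x : H} (hx : x ∈ X) :
    comul μ x = htmul x x :=
  comul_eq_iff.2 fun a b => by rw [hμ.inner_mul_of_mem hX hx, inner_htmul]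

theorem comul_of_perp (hμ : IsDiagonal X μ) {n : H} (hn : ∀ x ∈ X, inner ℂ x n = 0) :
    comul μ n = 0 :=
  comul_eq_iff.2 fun a b => by rw [hμ.inner_mul_of_perp hn, inner_zero_left]

theorem groupLike_eq (hμ : IsDiagonal X μ) (hX : IsOrthogonalSet X) : groupLike μ = X := by
  refine Set.Subset.antisymm (fun g hg => ?_) fun x hx =>
    ⟨ne_of_mem_of_not_mem hx hX.1, hμ.comul_of_mem hX hx⟩
  obtain ⟨x, hx, hgx⟩ : ∃ x ∈ X, inner ℂ x g ≠ 0 := by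
    by_contra! h
    have hgg := hμ.inner_mul_of_perp h g g
    rw [(mem_groupLike_iff.1 hg).2, mul_self_eq_zero, inner_self_eq_zero] at hgg
    exact hg.1 hgg
  rwa [eq_of_mem_groupLike_of_inner_ne_zero hg (hμ.mul_of_mem x hx)
    (mt inner_eq_zero_symm.1 hgx)]

theorem mul_ext (hμ : IsDiagonal X μ) (hX : IsOrthogonalSet X) {a b c d : H}
    (h : ∀ x ∈ X, inner ℂ x a * inner ℂ x b = inner ℂ x c * inner ℂ x d) :
    μ (htmul a b) = μ (htmul c d) := by
  have hperp : ∀ x ∈ X, inner ℂ x (μ (htmul a b) - μ (htmul c d)) = 0 := fun x hx => by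
    simp only [inner_sub_right, hμ.inner_mul_of_mem hX hx, h x hx, sub_self]
  rw [← sub_eq_zero, ← inner_self_eq_zero (𝕜 := ℂ)]
  simp only [inner_sub_right _ (μ (htmul a b)), hμ.inner_mul_of_perp hperp, sub_self]

theorem isFrobenius (hμ : IsDiagonal X μ) (hX : IsOrthogonalSet X) : IsFrobenius μ := by
  have hcomm (a b : H) : μ (htmul a b) = μ (htmul b a) :=
    hμ.mul_ext hX fun x _ => mul_comm _ _
  have hassoc (a b c : H) : μ (htmul (μ (htmul a b)) c) = μ (htmul a (μ (htmul b c))) :=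
    hμ.mul_ext hX fun x hx => by simp only [hμ.inner_mul_of_mem hX hx, mul_assoc]
  refine .of_forall_htmul hcomm hassoc (fun a b => ?_) fun a b => ?_
  · have h : comul μ ∘L (curry μ).flip b = hmap (.id ℂ H) ((curry μ).flip b) ∘L comul μ := by
      refine ext_of_eqOn_of_orthogonal (𝕜 := ℂ) (X := X) (fun x hx => ?_) fun n hn => ?_
      · simp [hμ.mul_of_mem x hx, hμ.comul_of_mem hX hx, htmul_smul]
      · simp [hμ.mul_of_perp n hn, hμ.comul_of_perp hn]
    exact DFunLike.congr_fun h a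
  · have h : comul μ ∘L curry μ a = hmap (curry μ a) (.id ℂ H) ∘L comul μ := by
      refine ext_of_eqOn_of_orthogonal (𝕜 := ℂ) (X := X) (fun x hx => ?_) fun n hn => ?_
      · simp [hcomm a, hμ.mul_of_mem x hx, hμ.comul_of_mem hX hx, smul_htmul]
      · simp [hcomm a, hμ.mul_of_perp n hn, hμ.comul_of_perp hn]
    exact DFunLike.congr_fun h b

end IsDiagonal

theorem isFrobenius_zero : IsFrobenius (0 : HTensor H H →L[ℂ] H) :=
  (isDiagonal_empty_iff.2 rfl).isFrobenius (by simp [IsOrthogonalSet])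

theorem IsOrthogonalSet.exists_hasSum (hX : IsOrthogonalSet X) (hb : IsBddAbove X) :
    ∃ μ : HTensor H H →L[ℂ] H, ∀ u v, HasSum
      (fun x : X => (inner ℂ (x : H) u * inner ℂ (x : H) v / (‖(x : H)‖ : ℂ) ^ 2) • (x : H))
      (μ (htmul u v)) := by
  obtain ⟨C, hC, hXC⟩ := hb
  have he := hX.orthonormal_normalize
  obtain ⟨μ, hμ⟩ := exists_hasSum_mul_inner_smul he
    ((orthonormal_htmul he he).comp (fun x : X => (x, x)) fun _ _ h => congrArg Prod.fst h)
    (c := fun x => (‖(x : H)‖ : ℂ)) hC.le fun x => by simpa using hXC x x.2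
  refine ⟨μ, fun u v => (hμ (htmul u v)).congr_fun fun x => ?_⟩
  have : (‖(x : H)‖ : ℂ) ≠ 0 := by
    simpa using ne_of_mem_of_not_mem x.2 hX.1
  simp only [Function.comp_apply, inner_htmul, inner_smul_left, map_inv₀, Complex.conj_ofReal,
    smul_smul]
  field_simp

theorem IsDiagonal.hasSum (hμ : IsDiagonal X μ) (hX : IsOrthogonalSet X) (hb : IsBddAbove X)
    (u v : H) : HasSum
      (fun x : X => (inner ℂ (x : H) u * inner ℂ (x : H) v / (‖(x : H)‖ : ℂ) ^ 2) • (x : H))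
      (μ (htmul u v)) := by
  obtain ⟨ν, hν⟩ := hX.exists_hasSum hb
  rw [hμ.unique (hX.isDiagonal_of_hasSum hν)]
  exact hν u v

end Diagonal

section Jacobson

variable {H : Type*} [NormedAddCommGroup H] [InnerProductSpace ℂ H] {μ : HTensor H H →L[ℂ] H}

theorem isMaximalModular_ker {χ : H →ₗ[ℂ] ℂ} (hχ : χ ≠ 0)
    (hmul : ∀ a b, χ (μ (htmul a b)) = χ a * χ b) : IsMaximalModular μ χ.ker := by
  have hsurj := LinearMap.surjective hχ
  have hcoatom : IsCoatom χ.ker := LinearMap.isCoatom_ker_of_surjective hsurj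
  obtain ⟨e, he⟩ := hsurj 1
  exact
    { isLeftIdeal := fun a x hx => by rw [LinearMap.mem_ker, hmul, hx, mul_zero]
      isModular := ⟨e, fun x => by simp [hmul, he]⟩
      ne_top := hcoatom.1
      maximal := fun I _ hle hI => (hcoatom.le_iff_eq hI).1 hle }

theorem mem_jacobson_of_mul_eq_zero {n : H} (hn : ∀ a, μ (htmul a n) = 0) : n ∈ jacobson μ := by
  refine Submodule.mem_sInf.2 fun I hI => ?_
  by_contra hnI
  -- `I + ℂ n` is a left ideal beyond `I`, hence all of `H`, so all products lie in `I`; then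
  -- modularity forces `I = H`.
  have hmul_mem (a : H) {x : H} (hx : x ∈ I ⊔ ℂ ∙ n) : μ (htmul a x) ∈ I := by
    obtain ⟨i, hi, y, hy, rfl⟩ := Submodule.mem_sup.1 hx
    obtain ⟨c, rfl⟩ := Submodule.mem_span_singleton.1 hy
    rw [← curry_apply, map_add, map_smul, curry_apply, curry_apply, hn, smul_zero, add_zero]
    exact hI.isLeftIdeal a i hi
  have htop : I ⊔ ℂ ∙ n = ⊤ := by
    by_contra h
    have heq := hI.maximal _ (fun a x hx => le_sup_left (a := I) (hmul_mem a hx)) le_sup_left h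
    exact hnI (heq ▸ Submodule.mem_sup_right (Submodule.mem_span_singleton_self n))
  obtain ⟨e, he⟩ := hI.isModular
  refine hI.ne_top ((Submodule.eq_top_iff').2 fun x => ?_)
  rw [← sub_add_cancel x (μ (htmul x e))]
  exact add_mem (he x) (hmul_mem x (htop ▸ Submodule.mem_top))

end Jacobson

section GroupLike

variable {H : Type*} [NormedAddCommGroup H] [InnerProductSpace ℂ H] [CompleteSpace H]
  {μ : HTensor H H →L[ℂ] H}

theorem norm_le_of_mem_groupLike {g : H} (hg : g ∈ groupLike μ) : ‖g‖ ≤ ‖μ‖ := by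
  refine le_of_mul_le_mul_right ?_ (norm_pos_iff.2 hg.1)
  calc ‖g‖ * ‖g‖ = ‖comul μ g‖ := by rw [hg.2, norm_htmul]
    _ ≤ ‖comul μ‖ * ‖g‖ := (comul μ).le_opNorm g
    _ = ‖μ‖ * ‖g‖ := by rw [LinearIsometryEquiv.norm_map]

theorem isBddAbove_groupLike : IsBddAbove (groupLike μ) :=
  ⟨‖μ‖ + 1, by positivity, fun _ hg =>
    (norm_le_of_mem_groupLike hg).trans (le_add_of_nonneg_right zero_le_one)⟩

end GroupLike

namespace IsFrobenius

variable {H : Type*} [NormedAddCommGroup H] [InnerProductSpace ℂ H] [CompleteSpace H]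
  {μ : HTensor H H →L[ℂ] H}

theorem mul_of_mem_groupLike (hμ : IsFrobenius μ) {g : H} (hg : g ∈ groupLike μ) (a : H) :
    μ (htmul g a) = inner ℂ g a • g := by
  have hga : comul μ (μ (htmul g a)) = htmul g (μ (htmul g a)) := by
    rw [hμ.comul_mul_eq_hmap_flip, hg.2, hmap_htmul]; rfl
  have hag : comul μ (μ (htmul g a)) = htmul (μ (htmul g a)) g := by
    rw [hμ.mul_comm, hμ.comul_mul_eq_hmap, hg.2, hmap_htmul]; rfl
  have h := inner_self_smul_eq_of_htmul_comm (hga.symm.trans hag)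
  rw [(mem_groupLike_iff.1 hg).2, mul_smul] at h
  exact smul_right_injective H (inner_self_ne_zero.2 hg.1) h

theorem isOrthogonalSet_groupLike (hμ : IsFrobenius μ) : IsOrthogonalSet (groupLike μ) :=
  ⟨fun h => h.1 rfl, fun _ hg _ hk hgk => not_imp_comm.1
    (eq_of_mem_groupLike_of_inner_ne_zero hg (hμ.mul_of_mem_groupLike hk)) hgk⟩

theorem curry_commute (hμ : IsFrobenius μ) (a b : H) : Commute (curry μ a) (curry μ b) := by
  ext c
  change μ (htmul a (μ (htmul b c))) = μ (htmul b (μ (htmul a c)))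
  rw [← hμ.mul_assoc, hμ.mul_comm a b, hμ.mul_assoc]

theorem curry_commute_star (hμ : IsFrobenius μ) (a b : H) :
    Commute (curry μ a) (star (curry μ b)) := by
  rw [ContinuousLinearMap.star_eq_adjoint]
  refine ContinuousLinearMap.ext fun c => ext_inner_left ℂ fun d => ?_
  calc inner ℂ d (μ (htmul a (adjoint (curry μ b) c)))
      = inner ℂ (comul μ d) (htmul (adjoint (curry μ b) c) a) := by
        rw [ContinuousLinearMap.adjoint_inner_left, hμ.mul_comm]
    _ = inner ℂ (hmap (curry μ b) (.id ℂ H) (comul μ d)) (htmul c a) := by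
        rw [← ContinuousLinearMap.adjoint_inner_right (hmap _ _), adjoint_hmap, hmap_htmul,
          ContinuousLinearMap.adjoint_id, ContinuousLinearMap.id_apply]
    _ = inner ℂ (μ (htmul b d)) (μ (htmul a c)) := by
        rw [← hμ.comul_mul_eq_hmap, ContinuousLinearMap.adjoint_inner_left, hμ.mul_comm c]
    _ = inner ℂ d (adjoint (curry μ b) (μ (htmul a c))) :=
        (ContinuousLinearMap.adjoint_inner_right (curry μ b) d _).symm

theorem exists_mem_groupLike_inner_ne_zero (hμ : IsFrobenius μ) {a b : H}
    (hab : μ (htmul a b) ≠ 0) : ∃ g ∈ groupLike μ, inner ℂ g a ≠ 0 := by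
  obtain ⟨χ, hχa, hχ⟩ := exists_multiplicative_functional_of_commute (curry μ)
    hμ.curry_commute hμ.curry_commute_star
    (a := a) fun h => hab (DFunLike.congr_fun h b)
  obtain ⟨g, rfl⟩ := (InnerProductSpace.toDual ℂ H).surjective χ
  refine ⟨g, mem_groupLike_iff.2 ⟨by rintro rfl; simp at hχa, fun x y => hχ x y _ ?_⟩, hχa⟩
  exact ContinuousLinearMap.ext fun c => hμ.mul_assoc x y c

theorem isDiagonal (hμ : IsFrobenius μ) : IsDiagonal (groupLike μ) μ where
  mul_of_mem _ hg := hμ.mul_of_mem_groupLike hg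
  mul_of_perp n hn b := by
    by_contra h
    obtain ⟨g, hg, hgn⟩ := hμ.exists_mem_groupLike_inner_ne_zero h
    exact hgn (hn g hg)

theorem groupLike_eq_empty_iff (hμ : IsFrobenius μ) : groupLike μ = ∅ ↔ μ = 0 := by
  refine ⟨fun h => isDiagonal_empty_iff.1 (h ▸ hμ.isDiagonal), ?_⟩
  rintro rfl
  exact (isDiagonal_empty_iff.2 rfl).groupLike_eq (by simp [IsOrthogonalSet])

theorem groupLike_nonempty_iff (hμ : IsFrobenius μ) : (groupLike μ).Nonempty ↔ μ ≠ 0 :=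
  Set.nonempty_iff_ne_empty.trans hμ.groupLike_eq_empty_iff.not

theorem mem_jacobson_iff (hμ : IsFrobenius μ) {n : H} :
    n ∈ jacobson μ ↔ ∀ g ∈ groupLike μ, inner ℂ g n = 0 := by
  refine ⟨fun hn g hg => ?_, fun hn => mem_jacobson_of_mul_eq_zero fun a => ?_⟩
  · have hker : IsMaximalModular μ (innerₛₗ ℂ g).ker :=
      isMaximalModular_ker (fun h => hg.1 (inner_self_eq_zero.1 (LinearMap.congr_fun h g)))
        (mem_groupLike_iff.1 hg).2
    exact Submodule.mem_sInf.1 hn _ hker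
  · rw [hμ.mul_comm, hμ.isDiagonal.mul_of_perp n hn]

theorem isSemisimple_iff (hμ : IsFrobenius μ) : IsSemisimple μ ↔ IsTotal (groupLike μ) := by
  simp only [IsSemisimple, Submodule.eq_bot_iff, hμ.mem_jacobson_iff, IsTotal]

theorem isRadical_iff (hμ : IsFrobenius μ) : IsRadical μ ↔ μ = 0 := by
  rw [← hμ.groupLike_eq_empty_iff, IsRadical, Submodule.eq_top_iff',
    Set.eq_empty_iff_forall_notMem]
  simp only [hμ.mem_jacobson_iff]
  exact ⟨fun h g hg => hg.1 (inner_self_eq_zero.1 (h g g hg)), fun h n g hg => (h g hg).elim⟩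

theorem mul_comul_of_mem_groupLike (hμ : IsFrobenius μ) {g : H} (hg : g ∈ groupLike μ) :
    μ (comul μ g) = (‖g‖ : ℂ) ^ 2 • g := by
  rw [hg.2, hμ.mul_of_mem_groupLike hg, inner_self_eq_norm_sq_to_K]; rfl

theorem isPartialIsometry_comul_iff (hμ : IsFrobenius μ) :
    IsPartialIsometry (comul μ) ↔ IsOrthonormalSet (groupLike μ) := by
  rw [IsPartialIsometry, ContinuousLinearMap.adjoint_adjoint]
  refine ⟨fun h => ⟨hμ.isOrthogonalSet_groupLike, fun g hg => ?_⟩, fun h => ?_⟩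
  · have hg0 : ‖g‖ ≠ 0 := norm_ne_zero_iff.2 hg.1
    have hcomul : ((‖g‖ : ℂ) ^ 2) • htmul g g = htmul g g := by
      have hg' : comul μ (μ (comul μ g)) = comul μ g := DFunLike.congr_fun h g
      rwa [hμ.mul_comul_of_mem_groupLike hg, map_smul, hg.2] at hg'
    have hnorm := congrArg norm hcomul
    rw [norm_smul, norm_htmul, mul_eq_right₀ (mul_ne_zero hg0 hg0), norm_pow, Complex.norm_real,
      norm_norm] at hnorm
    exact (pow_eq_one_iff_of_nonneg (norm_nonneg g) two_ne_zero).1 hnorm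
  · refine ext_of_eqOn_of_orthogonal (𝕜 := ℂ) (X := groupLike μ) (fun g hg => ?_) fun n hn => ?_
    · simp [hμ.mul_comul_of_mem_groupLike hg, h.2 g hg]
    · simp [hμ.isDiagonal.comul_of_perp hn]

theorem isSpecial_iff (hμ : IsFrobenius μ) :
    IsSpecial μ ↔ IsOrthonormalSet (groupLike μ) ∧ IsTotal (groupLike μ) := by
  refine ⟨fun h => ⟨?_, fun n hn => ?_⟩, fun ⟨h, htotal⟩ => ?_⟩
  · rw [← hμ.isPartialIsometry_comul_iff, IsPartialIsometry, ContinuousLinearMap.adjoint_adjoint,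
      show μ ∘L comul μ = _ from h, ContinuousLinearMap.comp_id]
  · simpa [hμ.isDiagonal.comul_of_perp hn] using! (DFunLike.congr_fun h n).symm
  · refine ext_of_eqOn_of_orthogonal (𝕜 := ℂ) (X := groupLike μ) (fun g hg => ?_) fun n hn => ?_
    · simp [hμ.mul_comul_of_mem_groupLike hg, h.2 g hg]
    · rw [htotal n hn, map_zero, map_zero]

end IsFrobenius

section Correspondence

variable {H : Type*} [NormedAddCommGroup H] [InnerProductSpace ℂ H]

theorem IsOrthonormalSet.isBddAbove {X : Set H} (hX : IsOrthonormalSet X) : IsBddAbove X :=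
  ⟨1, one_pos, fun x hx => (hX.2 x hx).le⟩

variable [CompleteSpace H]

theorem IsOrthonormalSet.exists_hilbertBasis {X : Set H} (hX : IsOrthonormalSet X)
    (htotal : IsTotal X) : ∃ b : HilbertBasis X ℂ H, ⇑b = Subtype.val := by
  have horth : Orthonormal ℂ (Subtype.val : X → H) :=
    ⟨fun x => hX.2 x x.2, fun x y hxy => hX.1.2 x.2 y.2 (Subtype.coe_ne_coe.2 hxy)⟩
  refine ⟨.mkOfOrthogonalEqBot horth ((Submodule.eq_bot_iff _).2 fun u hu => htotal u ?_), ?_⟩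
  · exact fun x hx => hu x (Submodule.subset_span ⟨⟨x, hx⟩, rfl⟩)
  · exact HilbertBasis.coe_mkOfOrthogonalEqBot _ _

theorem bijOn_groupLike : Set.BijOn (groupLike (H := H)) {μ | IsFrobenius μ}
    {X | IsOrthogonalSet X ∧ IsBddAbove X} := by
  refine ⟨fun μ hμ => ⟨hμ.isOrthogonalSet_groupLike, isBddAbove_groupLike⟩,
    fun μ hμ ν hν h => ?_, fun X ⟨hX, hb⟩ => ?_⟩
  · exact hμ.isDiagonal.unique (h ▸ hν.isDiagonal)
  · obtain ⟨μ, hμ⟩ := hX.exists_hasSum hb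
    have hdiag := hX.isDiagonal_of_hasSum hμ
    exact ⟨μ, hdiag.isFrobenius hX, hdiag.groupLike_eq hX⟩

theorem bijOn_groupLike_of_iff {p : (HTensor H H →L[ℂ] H) → Prop} {S : Set (Set H)}
    (hS : ∀ X ∈ S, IsOrthogonalSet X ∧ IsBddAbove X)
    (hp : ∀ μ, IsFrobenius μ → (p μ ↔ groupLike μ ∈ S)) :
    Set.BijOn (groupLike (H := H)) {μ | IsFrobenius μ ∧ p μ} S := by
  convert! bijOn_groupLike.subset_right hS using 1
  exact Set.ext fun μ => and_congr_right (hp μ)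

theorem exists_isUnitaryIso {μ ν : HTensor H H →L[ℂ] H} (hμ : IsFrobenius μ) (hsμ : IsSpecial μ)
    (hν : IsFrobenius ν) (hsν : IsSpecial ν) : ∃ U : H ≃ₗᵢ[ℂ] H, IsUnitaryIso μ ν U := by
  obtain ⟨hμ1, hμt⟩ := hμ.isSpecial_iff.1 hsμ
  obtain ⟨hν1, hνt⟩ := hν.isSpecial_iff.1 hsν
  obtain ⟨b, hb⟩ := hμ1.exists_hilbertBasis hμt
  obtain ⟨b', hb'⟩ := hν1.exists_hilbertBasis hνt
  obtain ⟨e⟩ := nonempty_equiv_of_hilbertBasis b b'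
  obtain ⟨U, hU⟩ := exists_linearIsometryEquiv_of_equiv b b' e
  have himage : U '' groupLike μ = groupLike ν := by
    calc U '' groupLike μ = Set.range (U ∘ b) := by rw [Set.range_comp, hb, Subtype.range_coe]
      _ = Set.range (b' ∘ e) := congrArg Set.range (funext hU)
      _ = groupLike ν := by rw [e.surjective.range_comp, hb', Subtype.range_coe]
  exact ⟨U, hμ.isDiagonal.isUnitaryIso (himage ▸ hν.isDiagonal)⟩

end Correspondence

end HilbFrob

theorem mainTheorem4 (H : Type*) [NormedAddCommGroup H] [InnerProductSpace ℂ H] [CompleteSpace H] :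
    Set.BijOn (HilbFrob.groupLike (H := H))
      {μ | HilbFrob.IsFrobenius μ ∧ μ ≠ 0}
      {X | X.Nonempty ∧ HilbFrob.IsOrthogonalSet X ∧ HilbFrob.IsBddAbove X} ∧
    Set.BijOn (HilbFrob.groupLike (H := H))
      {μ | HilbFrob.IsFrobenius μ ∧ HilbFrob.IsSemisimple μ}
      {X | HilbFrob.IsOrthogonalSet X ∧ HilbFrob.IsTotal X ∧ HilbFrob.IsBddAbove X} ∧
    Set.BijOn (HilbFrob.groupLike (H := H))
      {μ | HilbFrob.IsFrobenius μ ∧ HilbFrob.comul μ ≠ 0 ∧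
        HilbFrob.IsPartialIsometry (HilbFrob.comul μ)}
      {X | X.Nonempty ∧ HilbFrob.IsOrthonormalSet X} ∧
    (Set.BijOn (HilbFrob.groupLike (H := H))
        {μ | HilbFrob.IsFrobenius μ ∧ HilbFrob.IsSpecial μ}
        {X | HilbFrob.IsOrthonormalSet X ∧ HilbFrob.IsTotal X} ∧
      ∀ μ ν : HilbFrob.HTensor H H →L[ℂ] H,
        HilbFrob.IsFrobenius μ → HilbFrob.IsSpecial μ →
        HilbFrob.IsFrobenius ν → HilbFrob.IsSpecial ν →
        ∃ U : H ≃ₗᵢ[ℂ] H, HilbFrob.IsUnitaryIso μ ν U) ∧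
    ({μ : HilbFrob.HTensor H H →L[ℂ] H | HilbFrob.IsFrobenius μ ∧ HilbFrob.IsRadical μ} = {0} ∧
      ∀ μ : HilbFrob.HTensor H H →L[ℂ] H, HilbFrob.IsFrobenius μ →
        (HilbFrob.groupLike μ = ∅ ↔ μ = 0)) ∧
    (∀ μ : HilbFrob.HTensor H H →L[ℂ] H, HilbFrob.IsFrobenius μ → ∀ u v : H,
      HasSum (fun x : HilbFrob.groupLike μ =>
          ((inner ℂ (x : H) u * inner ℂ (x : H) v) / ((‖(x : H)‖ : ℂ) ^ 2)) • (x : H))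
        (μ (HilbFrob.htmul u v))) := by
  refine ⟨HilbFrob.bijOn_groupLike_of_iff (fun X hX => hX.2) fun μ hμ => ?nonzero,
    HilbFrob.bijOn_groupLike_of_iff (fun X hX => ⟨hX.1, hX.2.2⟩) fun μ hμ => ?semisimple,
    HilbFrob.bijOn_groupLike_of_iff (fun X hX => ⟨hX.2.1, hX.2.isBddAbove⟩)
      fun μ hμ => ?partialIsometry,
    ⟨HilbFrob.bijOn_groupLike_of_iff (fun X hX => ⟨hX.1.1, hX.1.isBddAbove⟩)
      fun μ hμ => hμ.isSpecial_iff, fun μ ν => HilbFrob.exists_isUnitaryIso⟩,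
    ⟨Set.ext fun μ => ⟨fun ⟨hμ, h⟩ => hμ.isRadical_iff.1 h, ?radical⟩,
      fun μ hμ => hμ.groupLike_eq_empty_iff⟩,
    fun μ hμ => hμ.isDiagonal.hasSum hμ.isOrthogonalSet_groupLike HilbFrob.isBddAbove_groupLike⟩
  case nonzero =>
    exact hμ.groupLike_nonempty_iff.symm.trans (and_iff_left
      ⟨hμ.isOrthogonalSet_groupLike, HilbFrob.isBddAbove_groupLike⟩).symm
  case semisimple =>
    exact hμ.isSemisimple_iff.trans
      ⟨fun h => ⟨hμ.isOrthogonalSet_groupLike, h, HilbFrob.isBddAbove_groupLike⟩, fun h => h.2.1⟩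
  case partialIsometry =>
    exact and_congr (hμ.groupLike_nonempty_iff.trans (by simp)).symm hμ.isPartialIsometry_comul_iff
  case radical =>
    rintro rfl
    exact ⟨HilbFrob.isFrobenius_zero, HilbFrob.isFrobenius_zero.isRadical_iff.2 rfl⟩
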